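/- A binary linear code $C\subseteq\mathbb F_2^n$ is self-dual if $C=C^\perp$ for the standard inner product. A self-dual code of length $n$ is extremal if its minimum weight equals $4\lfloor n/24\rfloor+4$ when $n\not\equiv 22\pmod{24}$, and $4\lfloor n/24\rfloor+6$ when $n\equiv 22\pmod{24}$. Let $C_0$ be the subcode of all codewords of $C$ of weight divisible by $4$; the shadow of $C$ is $S=C_0^\perp\setminus C$. Writing $n=24m+8l+2r$ with $l\in\{0,1,2\}$ and $r\in\{0,1,2,3\}$, the code $C$ is said to have minimal shadow if the minimum weight of $S$ is $r$ when $r\neq 0$, and $4$ when $r=0$. Theorem. For every integer $m\ge 0$ there is no extremal self-dual binary code with minimal shadow of length $24m+2$, $24m+4$, $24m+6$, $24m+10$ or $24m+22$. -/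

import Mathlib

/-- A binary linear code of length `n`: a linear subspace of `𝔽₂ⁿ`. -/
abbrev BinaryCode (n : ℕ) : Type := Submodule (ZMod 2) (Fin n → ZMod 2)

namespace BinaryCode

/-- The dual `X^⊥` of a set of binary words, with respect to the standard inner product
`x · y = ∑ i, x i * y i` over `𝔽₂`. -/
def dual {n : ℕ} (X : Set (Fin n → ZMod 2)) : BinaryCode n where
  carrier := {y | ∀ x ∈ X, ∑ i, x i * y i = 0}
  zero_mem' := by
    intro x _
    simp
  add_mem' := by
    intro a b ha hb x hx
    simp [mul_add, Finset.sum_add_distrib, ha x hx, hb x hx]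
  smul_mem' := by
    intro c a ha x hx
    have h : ∑ i, x i * (c • a) i = c * ∑ i, x i * a i := by
      rw [Finset.mul_sum]
      refine Finset.sum_congr rfl fun i _ => ?_
      simp only [Pi.smul_apply, smul_eq_mul]
      ring
    rw [h, ha x hx, mul_zero]

/-- `C` is self-dual: `C = C^⊥`. -/
def IsSelfDual {n : ℕ} (C : BinaryCode n) : Prop :=
  dual (C : Set (Fin n → ZMod 2)) = C

/-- `d` is the minimum weight of `C`: the least Hamming weight of a nonzero codeword. -/
def IsMinWeight {n : ℕ} (C : BinaryCode n) (d : ℕ) : Prop :=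
  IsLeast {w : ℕ | ∃ x ∈ C, x ≠ 0 ∧ hammingNorm x = w} d

/-- The upper bound for the minimum weight of a self-dual binary code of length `n`. -/
def extremalBound (n : ℕ) : ℕ :=
  if n % 24 = 22 then 4 * (n / 24) + 6 else 4 * (n / 24) + 4

/-- A self-dual code is extremal if its minimum weight meets the upper bound. -/
def IsExtremal {n : ℕ} (C : BinaryCode n) : Prop :=
  IsMinWeight C (extremalBound n)

/-- `C₀`, the set of codewords whose weight is divisible by four
(a linear subcode when `C` is self-dual). -/
def doublyEvenSubcode {n : ℕ} (C : BinaryCode n) : Set (Fin n → ZMod 2) :=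
  {x | x ∈ C ∧ 4 ∣ hammingNorm x}

/-- The shadow `S = C₀^⊥ \ C`. -/
def shadow {n : ℕ} (C : BinaryCode n) : Set (Fin n → ZMod 2) :=
  (dual (doublyEvenSubcode C) : Set (Fin n → ZMod 2)) \ (C : Set (Fin n → ZMod 2))

/-- The weight of a minimal shadow: if `n = 24m + 8l + 2r` with `l ∈ {0, 1, 2}` and
`r ∈ {0, 1, 2, 3}`, it is `r` for `r ≠ 0`, and `4` for `r = 0`. -/
def minimalShadowWeight (n : ℕ) : ℕ :=
  if n % 8 / 2 = 0 then 4 else n % 8 / 2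

/-- `C` is a code with minimal shadow: the shadow has a word of weight `minimalShadowWeight n`,
and this is the minimum weight of the shadow. -/
def HasMinimalShadow {n : ℕ} (C : BinaryCode n) : Prop :=
  IsLeast {w : ℕ | ∃ x ∈ shadow C, hammingNorm x = w} (minimalShadowWeight n)

end BinaryCode

/-! Write n = 2N with N = r + 4K and 0 ≤ r < 4. The shadow is a coset of C on which inner products
realise the character (-1)^(wt/2) of C, so Poisson summation expresses the weight enumerator of C
through that of the shadow (`IsSelfDual.sum_shadow_eq`). Shadow weights are ≡ r mod 4 and symmetric
under w ↦ n - w. Expanding the resulting palindromic form in PQ and (P - Q)^2 gives Gleason-type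
expansions of both enumerators with the same coefficients d_j, up to the factor (-64)^j / 2^N
(`IsSelfDual.exists_expansions`).

Each d_i is then computed twice by Bürmann–Lagrange inversion. From the code: if the minimum weight
exceeds 2i, the enumerator is 1 through degree i, so d_i is an explicit coefficient of a rational
function. From the shadow: d_i is a nonnegative combination of the numbers of shadow words of weight
r + 4j, j ≤ K - i. Equating the two values is `IsSelfDual.coeff_shadowSeries`.

A shadow word of weight r is the only one of weight w whenever r + w is below the minimum weight,
since two shadow words differ by a codeword. For lengths 24m+2, 24m+4, 24m+6 and 24m+10 this pins
down the shadow side, and the equation becomes an identity between binomial coefficients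
(`IsSelfDual.choose_identity`) that fails by size. For 24m+22 the code side vanishes by parity while
the shadow side is positive. Lengths 2, 4 and 6 have K = 0 and are handled directly. -/

open Finset

/-! ### Hamming weights and the sign character -/

namespace BinaryCode

variable {n : ℕ}

/-- The words of a set of binary words, as a finset. -/
noncomputable def words (X : Set (Fin n → ZMod 2)) : Finset (Fin n → ZMod 2) :=
  X.toFinite.toFinset

@[simp]
theorem mem_words {X : Set (Fin n → ZMod 2)} {x : Fin n → ZMod 2} : x ∈ words X ↔ x ∈ X :=
  Set.Finite.mem_toFinset _

/-- The number of words of weight `w` in a set of binary words. -/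
noncomputable def weightCount (X : Set (Fin n → ZMod 2)) (w : ℕ) : ℕ :=
  #{x ∈ words X | hammingNorm x = w}

theorem zmodTwo_cases (a : ZMod 2) : a = 0 ∨ a = 1 := by
  revert a; decide

theorem hammingNorm_eq_sum_val (x : Fin n → ZMod 2) : hammingNorm x = ∑ i, (x i).val := by
  rw [hammingNorm, Finset.card_filter]
  refine Finset.sum_congr rfl fun i _ => ?_
  rcases zmodTwo_cases (x i) with h | h <;> simp [h, ZMod.val_one]

theorem cast_hammingNorm (x : Fin n → ZMod 2) : (hammingNorm x : ZMod 2) = ∑ i, x i := by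
  simp [hammingNorm_eq_sum_val]

theorem hammingNorm_add_add (x y : Fin n → ZMod 2) :
    hammingNorm (x + y) + 2 * hammingNorm (x * y) = hammingNorm x + hammingNorm y := by
  simp only [hammingNorm_eq_sum_val, Finset.mul_sum, ← Finset.sum_add_distrib]
  refine Finset.sum_congr rfl fun i _ => ?_
  simp only [Pi.add_apply, Pi.mul_apply]
  generalize x i = a
  generalize y i = b
  revert a b
  decide

theorem hammingNorm_le (x : Fin n → ZMod 2) : hammingNorm x ≤ n := by
  simpa using hammingNorm_le_card_fintype (x := x)

theorem hammingNorm_add_one (x : Fin n → ZMod 2) : hammingNorm (x + 1) = n - hammingNorm x := by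
  have h : hammingNorm (x + 1) + hammingNorm x = n := by
    simp only [hammingNorm_eq_sum_val, ← Finset.sum_add_distrib]
    rw [Finset.sum_congr rfl (g := fun _ => 1)]
    · simp
    · intro i _
      simp only [Pi.add_apply, Pi.one_apply]
      generalize x i = a
      revert a
      decide
  omega

theorem prod_ite_eq_pow {R : Type*} [CommMonoid R] (a b : R) (x : Fin n → ZMod 2) :
    ∏ i, (if x i = 0 then a else b) = a ^ (n - hammingNorm x) * b ^ hammingNorm x := by
  rw [Finset.prod_ite, Finset.prod_const, Finset.prod_const]
  have h := Finset.card_filter_add_card_filter_not (s := (univ : Finset (Fin n))) (fun i => x i = 0)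
  simp only [card_univ, Fintype.card_fin] at h
  have h2 : #{i | ¬ x i = 0} = hammingNorm x := rfl
  rw [h2] at h ⊢
  congr 2
  omega

theorem word_add_self (x : Fin n → ZMod 2) : x + x = 0 := by
  ext i
  exact CharTwo.add_self_eq_zero _

/-- The nontrivial additive character of `𝔽₂`. -/
def sign (a : ZMod 2) : ℂ := if a = 0 then 1 else -1

@[simp] theorem sign_zero : sign 0 = 1 := by simp [sign]

@[simp] theorem sign_one : sign 1 = -1 := by simp [sign]

theorem sign_add (a b : ZMod 2) : sign (a + b) = sign a * sign b := by
  rcases zmodTwo_cases a with rfl | rfl <;> rcases zmodTwo_cases b with rfl | rfl <;>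
    simp [show (1 : ZMod 2) + 1 = 0 from rfl]

theorem sign_sum {ι : Type*} (s : Finset ι) (f : ι → ZMod 2) :
    sign (∑ i ∈ s, f i) = ∏ i ∈ s, sign (f i) := by
  classical
  induction s using Finset.induction_on with
  | empty => simp
  | insert a s ha ih => rw [Finset.sum_insert ha, Finset.prod_insert ha, sign_add, ih]

theorem sign_natCast (k : ℕ) : sign (k : ZMod 2) = (-1) ^ k := by
  induction k with
  | zero => simp
  | succ k ih => rw [Nat.cast_succ, sign_add, ih, sign_one, pow_succ]

theorem sum_mul_comm (x y : Fin n → ZMod 2) : ∑ i, x i * y i = ∑ i, y i * x i :=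
  Finset.sum_congr rfl fun _ _ => mul_comm _ _

theorem sum_add_mul (x x' y : Fin n → ZMod 2) :
    ∑ i, (x + x') i * y i = ∑ i, x i * y i + ∑ i, x' i * y i := by
  simp [add_mul, Finset.sum_add_distrib]

/-! ### Self-dual codes and the shadow as a coset -/

variable {C : BinaryCode n}

theorem IsSelfDual.mem_iff (hC : IsSelfDual C) {y : Fin n → ZMod 2} :
    y ∈ C ↔ ∀ x ∈ C, ∑ i, x i * y i = 0 := by
  conv_lhs => rw [← show dual (C : Set (Fin n → ZMod 2)) = C from hC]
  rfl

theorem IsSelfDual.even_hammingNorm (hC : IsSelfDual C) {x : Fin n → ZMod 2} (hx : x ∈ C) :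
    Even (hammingNorm x) := by
  rw [← ZMod.natCast_eq_zero_iff_even, cast_hammingNorm, ← hC.mem_iff.1 hx x hx]
  refine Finset.sum_congr rfl fun i _ => ?_
  rcases zmodTwo_cases (x i) with h | h <;> simp [h]

theorem IsSelfDual.one_mem (hC : IsSelfDual C) : (1 : Fin n → ZMod 2) ∈ C := by
  rw [hC.mem_iff]
  intro x hx
  simpa [← cast_hammingNorm, ZMod.natCast_eq_zero_iff_even] using hC.even_hammingNorm hx

theorem IsSelfDual.even_length (hC : IsSelfDual C) : Even n := by
  have h := hC.even_hammingNorm hC.one_mem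
  have h1 : hammingNorm (1 : Fin n → ZMod 2) = n := by simp [hammingNorm_eq_sum_val, ZMod.val_one]
  rwa [h1] at h

theorem IsSelfDual.even_hammingNorm_mul (hC : IsSelfDual C) {x y : Fin n → ZMod 2}
    (hx : x ∈ C) (hy : y ∈ C) : Even (hammingNorm (x * y)) := by
  rw [← ZMod.natCast_eq_zero_iff_even, cast_hammingNorm]
  exact hC.mem_iff.1 hy x hx

/-- A word of the shadow induces on `C` the character `c ↦ (-1) ^ (wt c / 2)`. -/
theorem IsSelfDual.sum_mul_shadow (hC : IsSelfDual C) {s c : Fin n → ZMod 2}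
    (hs : s ∈ shadow C) (hc : c ∈ C) :
    ∑ i, c i * s i = ((hammingNorm c / 2 : ℕ) : ZMod 2) := by
  obtain ⟨hs0, hsC⟩ := hs
  have key : ∀ x ∈ C, 4 ∣ hammingNorm x → ∑ i, x i * s i = 0 := fun x hx h => hs0 x ⟨hx, h⟩
  obtain ⟨t, ht, hts⟩ : ∃ t ∈ C, ∑ i, t i * s i ≠ 0 := by
    by_contra! h
    exact hsC (hC.mem_iff.2 h)
  by_cases h4 : 4 ∣ hammingNorm c
  · rw [key c hc h4, eq_comm, ZMod.natCast_eq_zero_iff_even]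
    obtain ⟨k, hk⟩ := h4
    exact ⟨k, by omega⟩
  · have ht4 : ¬ 4 ∣ hammingNorm t := fun h => hts (key t ht h)
    have h1 := hammingNorm_add_add c t
    obtain ⟨a, ha⟩ := hC.even_hammingNorm hc
    obtain ⟨b, hb⟩ := hC.even_hammingNorm ht
    obtain ⟨e, he⟩ := hC.even_hammingNorm_mul hc ht
    -- Both weights are 2 mod 4 and the overlap is even, so wt(c + t) is divisible by 4: any two
    -- words of C outside the doubly-even part have equal inner product with s.
    have h2 := key (c + t) (C.add_mem hc ht) (by omega)
    rw [sum_add_mul, (zmodTwo_cases (∑ i, t i * s i)).resolve_left hts] at h2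
    have hodd : Odd (hammingNorm c / 2) := by
      rw [← Nat.not_even_iff_odd]
      rintro ⟨k, hk⟩
      omega
    rw [ZMod.natCast_eq_one_iff_odd.2 hodd]
    rcases zmodTwo_cases (∑ i, c i * s i) with h | h
    · rw [h] at h2; simp at h2
    · exact h

theorem IsSelfDual.sum_mul_add_shadow (hC : IsSelfDual C) {s t c : Fin n → ZMod 2}
    (hs : s ∈ shadow C) (ht : t ∈ shadow C) (hc : c ∈ C) : ∑ i, c i * (s + t) i = 0 := by
  simp only [Pi.add_apply, mul_add, Finset.sum_add_distrib]
  rw [hC.sum_mul_shadow hs hc, hC.sum_mul_shadow ht hc]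
  exact CharTwo.add_self_eq_zero _

theorem IsSelfDual.add_mem_of_mem_shadow (hC : IsSelfDual C) {s t : Fin n → ZMod 2}
    (hs : s ∈ shadow C) (ht : t ∈ shadow C) : s + t ∈ C :=
  hC.mem_iff.2 fun _ hc => hC.sum_mul_add_shadow hs ht hc

theorem IsSelfDual.add_mem_shadow (hC : IsSelfDual C) {s c : Fin n → ZMod 2}
    (hs : s ∈ shadow C) (hc : c ∈ C) : c + s ∈ shadow C := by
  refine ⟨(dual (doublyEvenSubcode C)).add_mem (fun x hx => hC.mem_iff.1 hc x hx.1) hs.1, ?_⟩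
  intro h
  exact hs.2 (by simpa using C.sub_mem h hc)

theorem IsSelfDual.sum_shadow (hC : IsSelfDual C) {s : Fin n → ZMod 2} (hs : s ∈ shadow C)
    {R : Type*} [AddCommMonoid R] (f : (Fin n → ZMod 2) → R) :
    ∑ x ∈ words (shadow C), f x = ∑ c ∈ words (C : Set (Fin n → ZMod 2)), f (c + s) := by
  refine (Finset.sum_bij (fun c _ => c + s) ?_ ?_ ?_ ?_).symm
  · intro c hc
    exact mem_words.2 (hC.add_mem_shadow hs (mem_words.1 hc))
  · intro c _ c' _ h
    exact add_right_cancel h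
  · intro x hx
    refine ⟨x + s, mem_words.2 (hC.add_mem_of_mem_shadow (mem_words.1 hx) hs), ?_⟩
    rw [add_assoc, word_add_self, add_zero]
  · intros; rfl

/-- The all-ones word lies in C, so complementation permutes the shadow. -/
theorem IsSelfDual.weightCount_shadow_sub (hC : IsSelfDual C) {w : ℕ} (hw : w ≤ n) :
    weightCount (shadow C) (n - w) = weightCount (shadow C) w := by
  refine Finset.card_bij (fun x _ => 1 + x) ?_ ?_ ?_
  · intro x hx
    simp only [Finset.mem_filter, mem_words] at hx ⊢
    refine ⟨hC.add_mem_shadow hx.1 hC.one_mem, ?_⟩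
    rw [add_comm, hammingNorm_add_one]
    omega
  · intro c _ c' _ h
    exact add_left_cancel h
  · intro x hx
    simp only [Finset.mem_filter, mem_words] at hx
    refine ⟨1 + x, ?_, ?_⟩
    · simp only [Finset.mem_filter, mem_words]
      refine ⟨hC.add_mem_shadow hx.1 hC.one_mem, ?_⟩
      rw [add_comm, hammingNorm_add_one]
      omega
    · rw [← add_assoc, word_add_self, zero_add]

/-! ### Poisson summation and the shadow identity -/

/-- Orthogonality of characters: for x outside C some t in C has t · x = 1, and translation by t
negates the sum. -/
theorem IsSelfDual.sum_sign (hC : IsSelfDual C) (x : Fin n → ZMod 2) [Decidable (x ∈ C)] :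
    ∑ y ∈ words (C : Set (Fin n → ZMod 2)), sign (∑ i, x i * y i) =
      if x ∈ C then (#(words (C : Set (Fin n → ZMod 2))) : ℂ) else 0 := by
  split_ifs with hx
  · rw [Finset.sum_congr rfl (g := fun _ => 1)]
    · simp
    · intro y hy
      rw [hC.mem_iff.1 (mem_words.1 hy) x hx, sign_zero]
  · obtain ⟨t, ht, hts⟩ : ∃ t ∈ C, ∑ i, t i * x i ≠ 0 := by
      by_contra! h
      exact hx (hC.mem_iff.2 h)
    rw [sum_mul_comm] at hts
    have h1 : ∑ y ∈ words (C : Set (Fin n → ZMod 2)), sign (∑ i, x i * y i) =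
        ∑ y ∈ words (C : Set (Fin n → ZMod 2)), sign (∑ i, x i * (t + y) i) := by
      refine (Finset.sum_bij (fun y _ => t + y) ?_ ?_ ?_ ?_).symm
      · intro c hc
        exact mem_words.2 (C.add_mem ht (mem_words.1 hc))
      · intro c _ c' _ h
        exact add_left_cancel h
      · intro c hc
        refine ⟨t + c, mem_words.2 (C.add_mem ht (mem_words.1 hc)), ?_⟩
        rw [← add_assoc, word_add_self, zero_add]
      · intros; rfl
    have h2 : ∀ y : Fin n → ZMod 2, sign (∑ i, x i * (t + y) i) = - sign (∑ i, x i * y i) := by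
      intro y
      simp only [Pi.add_apply, mul_add, Finset.sum_add_distrib]
      rw [sign_add, (zmodTwo_cases _).resolve_left hts, sign_one, neg_one_mul]
    simp only [h2, Finset.sum_neg_distrib] at h1
    exact self_eq_neg.1 h1

/-- Poisson summation for a self-dual code. -/
theorem IsSelfDual.card_mul_sum (hC : IsSelfDual C) (h : (Fin n → ZMod 2) → ℂ) :
    (#(words (C : Set (Fin n → ZMod 2))) : ℂ) * ∑ c ∈ words (C : Set (Fin n → ZMod 2)), h c =
      ∑ y ∈ words (C : Set (Fin n → ZMod 2)), ∑ x, sign (∑ i, x i * y i) * h x := by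
  classical
  rw [Finset.sum_comm]
  simp only [← Finset.sum_mul, hC.sum_sign, ite_mul, zero_mul]
  rw [← Finset.sum_filter, Finset.mul_sum]
  refine Finset.sum_congr ?_ fun _ _ => rfl
  ext x
  simp

/-- The Fourier transform of a product function factors over coordinates; the shift by s contributes
the character of s. -/
theorem sum_sign_mul_prod (s y : Fin n → ZMod 2) (a b : ℂ) :
    ∑ x : Fin n → ZMod 2, sign (∑ i, x i * y i) * ∏ i, (if (x + s) i = 0 then a else b) =
      sign (∑ i, y i * s i) * ((a + b) ^ (n - hammingNorm y) * (a - b) ^ hammingNorm y) := by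
  simp only [sign_sum, ← Finset.prod_mul_distrib]
  rw [← prod_ite_eq_pow, ← Finset.prod_mul_distrib]
  have h := Finset.prod_univ_sum (fun _ : Fin n => (univ : Finset (ZMod 2)))
    (fun i t => sign (t * y i) * if t + s i = 0 then a else b)
  rw [Fintype.piFinset_univ] at h
  simp only [Pi.add_apply]
  rw [← h]
  refine Finset.prod_congr rfl fun i _ => ?_
  have hu : (univ : Finset (ZMod 2)) = {0, 1} := rfl
  rw [hu, Finset.sum_pair (by decide)]
  have h11 : (1 : ZMod 2) + 1 = 0 := rfl
  rcases zmodTwo_cases (y i) with h | h <;> rcases zmodTwo_cases (s i) with h' | h' <;>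
    simp [h, h', h11] <;> ring

/-- The weight enumerator of a self-dual code in terms of the one of its shadow. -/
theorem IsSelfDual.card_mul_sum_shadow (hC : IsSelfDual C) (hS : (shadow C).Nonempty) (z : ℂ) :
    (#(words (C : Set (Fin n → ZMod 2))) : ℂ) * ∑ x ∈ words (shadow C),
        (1 - Complex.I * z) ^ (n - hammingNorm x) * (1 + Complex.I * z) ^ hammingNorm x =
      2 ^ n * ∑ c ∈ words (C : Set (Fin n → ZMod 2)), z ^ hammingNorm c := by
  obtain ⟨s, hs⟩ := hS
  rw [hC.sum_shadow hs]
  simp only [← prod_ite_eq_pow]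
  rw [hC.card_mul_sum, Finset.mul_sum]
  refine Finset.sum_congr rfl fun y hy => ?_
  have hy := mem_words.1 hy
  rw [sum_sign_mul_prod, hC.sum_mul_shadow hs hy, sign_natCast]
  obtain ⟨k, hk⟩ := hC.even_hammingNorm hy
  have hle := hammingNorm_le y
  have hk2 : hammingNorm y / 2 = k := by omega
  rw [hk2, show (1 - Complex.I * z + (1 + Complex.I * z)) = 2 by ring,
    show (1 - Complex.I * z - (1 + Complex.I * z)) = 2 * (-Complex.I * z) by ring,
    mul_pow, ← mul_assoc (2 ^ _), ← pow_add, Nat.sub_add_cancel hle, mul_pow]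
  -- This sign cancels the shadow character (-1)^(wt/2), which is why the variable was taken to be
  -- iz.
  have hI : (-Complex.I) ^ hammingNorm y = (-1) ^ k := by
    rw [hk, ← two_mul, pow_mul]
    simp
  rw [hI, mul_left_comm, ← mul_assoc ((-1) ^ k), ← mul_pow]
  simp

theorem IsSelfDual.card_words_shadow (hC : IsSelfDual C) (hS : (shadow C).Nonempty) :
    #(words (shadow C)) = #(words (C : Set (Fin n → ZMod 2))) := by
  obtain ⟨s, hs⟩ := hS
  simpa only [Finset.card_eq_sum_ones] using hC.sum_shadow hs (fun _ => 1)

/-- At z = 0 the shadow identity reads |C| · |S| = 2^n, and |S| = |C|. -/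
theorem IsSelfDual.card_words (hC : IsSelfDual C) (hS : (shadow C).Nonempty) :
    #(words (C : Set (Fin n → ZMod 2))) = 2 ^ (n / 2) := by
  have h := hC.card_mul_sum_shadow hS 0
  have h0 : ∑ c ∈ words (C : Set (Fin n → ZMod 2)), (0 : ℂ) ^ hammingNorm c = 1 := by
    rw [Finset.sum_eq_single_of_mem 0 (by simp)]
    · simp
    · intro b _ hb
      exact zero_pow (hammingNorm_ne_zero_iff.2 hb)
  rw [h0] at h
  simp only [mul_zero, sub_zero, add_zero, one_pow, mul_one, Finset.sum_const, nsmul_eq_mul,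
    hC.card_words_shadow hS] at h
  have h2 : #(words (C : Set (Fin n → ZMod 2))) ^ 2 = (2 ^ (n / 2)) ^ 2 := by
    rw [← pow_mul, Nat.div_mul_cancel hC.even_length.two_dvd, sq]
    exact_mod_cast h
  exact Nat.pow_left_injective (by norm_num) h2

theorem IsSelfDual.sum_shadow_eq (hC : IsSelfDual C) (hS : (shadow C).Nonempty) (z : ℂ) :
    ∑ x ∈ words (shadow C),
        (1 - Complex.I * z) ^ (n - hammingNorm x) * (1 + Complex.I * z) ^ hammingNorm x =
      2 ^ (n / 2) * ∑ c ∈ words (C : Set (Fin n → ZMod 2)), z ^ hammingNorm c := by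
  have h := hC.card_mul_sum_shadow hS z
  rw [hC.card_words hS] at h
  have h2 : (2 : ℂ) ^ n = 2 ^ (n / 2) * 2 ^ (n / 2) := by
    rw [← pow_add, ← two_mul, Nat.mul_div_cancel' hC.even_length.two_dvd]
  rw [h2, mul_assoc] at h
  push_cast at h
  exact mul_left_cancel₀ (pow_ne_zero _ two_ne_zero) h

theorem mod_four_eq_of_re_eq_one {N w : ℕ}
    (h : ((-Complex.I) ^ N * Complex.I ^ w).re = 1) : w % 4 = N % 4 := by
  have h1 : (-Complex.I) ^ N = Complex.I ^ (3 * N) := by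
    rw [pow_mul, Complex.I_pow_three]
  rw [h1, ← pow_add, Complex.I_pow_eq_pow_mod] at h
  have h4 : (3 * N + w) % 4 < 4 := Nat.mod_lt _ (by norm_num)
  have h0 : (3 * N + w) % 4 = 0 := by
    generalize (3 * N + w) % 4 = q at *
    interval_cases q
    · rfl
    all_goals norm_num [Complex.I_pow_three] at h
  omega

/-- At z = 1 each shadow term is 2^(n/2) times a power of i, while the total is 2^(n/2) |C| =
2^(n/2) |S|. Real parts of unit complex numbers are at most 1, so equality forces every one of these
powers of i to be 1. -/
theorem IsSelfDual.hammingNorm_mod_four (hC : IsSelfDual C) {s : Fin n → ZMod 2}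
    (hs : s ∈ shadow C) : hammingNorm s % 4 = (n / 2) % 4 := by
  have h := hC.sum_shadow_eq ⟨s, hs⟩ 1
  have hn := Nat.mul_div_cancel' hC.even_length.two_dvd
  have hI : ((1 : ℂ) + Complex.I) = (1 - Complex.I) * Complex.I := by
    ring_nf; simp; ring
  have hI2 : ((1 : ℂ) - Complex.I) ^ 2 = 2 * -Complex.I := by
    ring_nf; simp; ring
  have hterm : ∀ x : Fin n → ZMod 2,
      (1 - Complex.I * 1) ^ (n - hammingNorm x) * (1 + Complex.I * 1) ^ hammingNorm x =
        2 ^ (n / 2) * ((-Complex.I) ^ (n / 2) * Complex.I ^ hammingNorm x) := by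
    intro x
    rw [mul_one, hI, mul_pow, ← mul_assoc, ← pow_add, Nat.sub_add_cancel (hammingNorm_le x)]
    have hpow : ((1 : ℂ) - Complex.I) ^ n = 2 ^ (n / 2) * (-Complex.I) ^ (n / 2) := by
      rw [← mul_pow, ← hI2, ← pow_mul, hn]
    rw [hpow, mul_assoc]
  simp only [hterm, one_pow] at h
  rw [← Finset.mul_sum] at h
  have h3 := congrArg Complex.re (mul_left_cancel₀ (pow_ne_zero _ two_ne_zero) h)
  rw [Complex.re_sum] at h3
  have hle : ∀ x ∈ words (shadow C),
      ((-Complex.I) ^ (n / 2) * Complex.I ^ hammingNorm x).re ≤ 1 := by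
    intro x _
    refine (Complex.re_le_norm _).trans (le_of_eq ?_)
    simp
  refine mod_four_eq_of_re_eq_one ((Finset.sum_eq_sum_iff_of_le hle).1 ?_ s (mem_words.2 hs))
  rw [h3]
  simp [hC.card_words_shadow ⟨s, hs⟩]

end BinaryCode

/-! ### Palindromic binary forms -/

theorem sub_pow_eq_sum {R : Type*} [CommRing R] (P Q : R) (M : ℕ) :
    (P - Q) ^ M = ∑ j ∈ range (M + 1), (((-1) ^ j * M.choose j : ℤ) : R) * P ^ (M - j) * Q ^ j := by
  rw [sub_eq_neg_add, add_pow]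
  refine Finset.sum_congr rfl fun j _ => ?_
  rw [neg_pow]
  push_cast
  ring

/-- A palindromic binary form of degree `2K` is a polynomial in `PQ` and `(P - Q) ^ 2`. -/
theorem exists_expansion_of_palindromic (K : ℕ) (b : ℕ → ℤ)
    (hb : ∀ j ≤ 2 * K, b (2 * K - j) = b j) :
    ∃ d : ℕ → ℤ, ∀ (R : Type) [CommRing R] (P Q : R),
      ∑ j ∈ range (2 * K + 1), (b j : R) * P ^ (2 * K - j) * Q ^ j =
        ∑ j ∈ range (K + 1), (d j : R) * (P * Q) ^ (K - j) * (P - Q) ^ (2 * j) := by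
  induction K generalizing b with
  | zero => exact ⟨b, fun R _ P Q => by simp⟩
  | succ K ih =>
    -- Subtracting b 0 · (P - Q)^(2K+2) kills both end coefficients by symmetry. The rest is PQ
    -- times a palindromic form of degree 2K.
    set e : ℕ → ℤ := fun j => b j - b 0 * ((-1) ^ j * (2 * K + 2).choose j) with he
    have hsymm : ∀ j ≤ 2 * K + 2, e (2 * K + 2 - j) = e j := by
      intro j hj
      have h1 : (-1 : ℤ) ^ (2 * K + 2 - j) = (-1) ^ j := by
        rcases Nat.even_or_odd j with h | h
        · rw [h.neg_one_pow, Even.neg_one_pow]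
          rw [Nat.even_sub hj]
          exact iff_of_true ⟨K + 1, by ring⟩ h
        · rw [h.neg_one_pow, Odd.neg_one_pow]
          rw [Nat.odd_sub hj]
          exact iff_of_false (Nat.not_odd_iff_even.2 ⟨K + 1, by ring⟩) (Nat.not_even_iff_odd.2 h)
      simp only [he]
      rw [h1, Nat.choose_symm hj, show b (2 * K + 2 - j) = b j from hb j hj]
    have he0 : e 0 = 0 := by simp [he]
    have heK : e (2 * K + 2) = 0 := by simpa [he0] using hsymm 0 (by omega)
    obtain ⟨d, hd⟩ := ih (fun j => e (j + 1)) (fun j hj => by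
      rw [← hsymm (j + 1) (by omega)]
      congr 1
      omega)
    refine ⟨fun j => if j = K + 1 then b 0 else d j, fun R _ P Q => ?_⟩
    have hsplit : ∑ j ∈ range (2 * K + 3), (b j : R) * P ^ (2 * K + 2 - j) * Q ^ j =
        ∑ j ∈ range (2 * K + 3), (e j : R) * P ^ (2 * K + 2 - j) * Q ^ j +
          b 0 * (P - Q) ^ (2 * K + 2) := by
      rw [sub_pow_eq_sum, Finset.mul_sum, ← Finset.sum_add_distrib]
      refine Finset.sum_congr rfl fun j _ => ?_
      simp only [he]
      push_cast
      ring
    have hinner : ∑ j ∈ range (2 * K + 3), (e j : R) * P ^ (2 * K + 2 - j) * Q ^ j =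
        P * Q * ∑ j ∈ range (2 * K + 1), (e (j + 1) : R) * P ^ (2 * K - j) * Q ^ j := by
      rw [Finset.sum_range_succ, Finset.sum_range_succ', heK, he0, Finset.mul_sum]
      simp only [Int.cast_zero, zero_mul, add_zero]
      refine Finset.sum_congr rfl fun j hj => ?_
      rw [show 2 * K + 2 - (j + 1) = (2 * K - j) + 1 by
        have := Finset.mem_range.1 hj; omega]
      ring
    rw [show 2 * (K + 1) = 2 * K + 2 by ring, hsplit, hinner, hd, Finset.sum_range_succ _ (K + 1)]
    congr 1
    · rw [Finset.mul_sum]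
      refine Finset.sum_congr rfl fun j hj => ?_
      have hj := Finset.mem_range.1 hj
      simp only [if_neg (show j ≠ K + 1 by omega)]
      rw [show K + 1 - j = (K - j) + 1 by omega]
      ring
    · simp [mul_add]

/-! ### Inversion of power series expansions -/

namespace PowerSeries

theorem one_sub_X_inv_mul : (1 - X : ℝ⟦X⟧)⁻¹ * (1 - X) = 1 :=
  PowerSeries.inv_mul_cancel _ (by simp)

theorem one_add_X_inv_mul : (1 + X : ℝ⟦X⟧)⁻¹ * (1 + X) = 1 :=
  PowerSeries.inv_mul_cancel _ (by simp)

theorem one_sub_X_inv : (1 - X : ℝ⟦X⟧)⁻¹ = mk 1 := by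
  have h := mk_one_mul_one_sub_eq_one ℝ
  calc (1 - X : ℝ⟦X⟧)⁻¹ = (mk 1 * (1 - X)) * (1 - X)⁻¹ := by rw [h, one_mul]
    _ = mk 1 * ((1 - X)⁻¹ * (1 - X)) := by ring
    _ = mk 1 := by rw [one_sub_X_inv_mul, mul_one]

theorem coeff_one_sub_X_inv_pow (q k : ℕ) :
    coeff k ((1 - X : ℝ⟦X⟧)⁻¹ ^ (q + 1)) = ((q + k).choose q : ℝ) := by
  rw [one_sub_X_inv, mk_one_pow_eq_mk_choose_add, coeff_mk]

theorem coeff_X_mul_derivative (f : ℝ⟦X⟧) (k : ℕ) :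
    coeff k (X * d⁄dX ℝ f) = k * coeff k f := by
  cases k with
  | zero => simp
  | succ k =>
    rw [coeff_succ_X_mul, coeff_derivative]
    push_cast
    ring

theorem derivative_one_sub_X_inv_pow (k : ℕ) :
    d⁄dX ℝ ((1 - X : ℝ⟦X⟧)⁻¹ ^ k) = (k : ℝ⟦X⟧) * (1 - X)⁻¹ ^ (k + 1) := by
  rw [derivative_pow, derivative_inv']
  cases k with
  | zero => simp
  | succ k => simp; ring

theorem derivative_one_add_X_inv_pow (k : ℕ) :
    d⁄dX ℝ ((1 + X : ℝ⟦X⟧)⁻¹ ^ k) = -(k : ℝ⟦X⟧) * (1 + X)⁻¹ ^ (k + 1) := by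
  rw [derivative_pow, derivative_inv']
  cases k with
  | zero => simp
  | succ k => simp; ring

theorem coeff_natCast_mul (f : ℝ⟦X⟧) (a k : ℕ) :
    coeff k ((a : ℝ⟦X⟧) * f) = a * coeff k f := by
  rw [← map_natCast (C : ℝ →+* ℝ⟦X⟧), coeff_C_mul]

/-- Divided by X^(k+2), the series is up to a constant the derivative of (1 - X)^(2k+2) / X^(k+1),
so it has no residue. -/
theorem coeff_one_sub_X_pow_mul (k : ℕ) :
    coeff (k + 1) ((1 - X : ℝ⟦X⟧) ^ (2 * k + 1) * (1 + X)) = 0 := by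
  have hder : d⁄dX ℝ ((1 - X : ℝ⟦X⟧) ^ (2 * k + 2)) =
      -((2 * k + 2 : ℕ) : ℝ⟦X⟧) * (1 - X) ^ (2 * k + 1) := by
    rw [derivative_pow]
    simp
    ring
  have h := coeff_X_mul_derivative ((1 - X : ℝ⟦X⟧) ^ (2 * k + 2)) (k + 1)
  have hid : X * d⁄dX ℝ ((1 - X : ℝ⟦X⟧) ^ (2 * k + 2)) = ((k + 1 : ℕ) : ℝ⟦X⟧) *
      (1 - X) ^ (2 * k + 2) - ((k + 1 : ℕ) : ℝ⟦X⟧) * ((1 - X) ^ (2 * k + 1) * (1 + X)) := by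
    rw [hder]
    push_cast
    ring
  rw [hid, map_sub, coeff_natCast_mul, coeff_natCast_mul, sub_eq_self] at h
  exact (mul_eq_zero.1 h).resolve_left (by positivity)

/-- The same residue argument for the derivative of (1 + X)^(4k+4) (1 - X)^(-2k-2) / X^(k+1); the
factor 1 - 6X + X² comes from the logarithmic derivative of X (1 - X)² / (1 + X)⁴. -/
theorem coeff_one_add_X_pow_mul (k : ℕ) :
    coeff (k + 1) ((1 + X : ℝ⟦X⟧) ^ (4 * k + 3) * (1 - 6 * X + X ^ 2) *
      (1 - X)⁻¹ ^ (2 * k + 3)) = 0 := by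
  have hder : d⁄dX ℝ ((1 + X : ℝ⟦X⟧) ^ (4 * k + 4)) =
      ((4 * k + 4 : ℕ) : ℝ⟦X⟧) * (1 + X) ^ (4 * k + 3) := by
    rw [derivative_pow]
    simp
  have h := coeff_X_mul_derivative ((1 + X : ℝ⟦X⟧) ^ (4 * k + 4) * (1 - X)⁻¹ ^ (2 * k + 2)) (k + 1)
  have hid : X * d⁄dX ℝ ((1 + X : ℝ⟦X⟧) ^ (4 * k + 4) * (1 - X)⁻¹ ^ (2 * k + 2)) =
      ((k + 1 : ℕ) : ℝ⟦X⟧) * ((1 + X) ^ (4 * k + 4) * (1 - X)⁻¹ ^ (2 * k + 2)) -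
      ((k + 1 : ℕ) : ℝ⟦X⟧) * ((1 + X) ^ (4 * k + 3) * (1 - 6 * X + X ^ 2) *
        (1 - X)⁻¹ ^ (2 * k + 3)) := by
    rw [Derivation.leibniz, hder, derivative_one_sub_X_inv_pow]
    have hw : (1 - X : ℝ⟦X⟧)⁻¹ ^ (2 * k + 2) = (1 - X)⁻¹ ^ (2 * k + 3) * (1 - X) := by
      rw [pow_succ _ (2 * k + 2), mul_assoc, one_sub_X_inv_mul, mul_one]
    simp only [smul_eq_mul]
    rw [hw]
    push_cast
    ring
  rw [hid, map_sub, coeff_natCast_mul, coeff_natCast_mul, sub_eq_self] at h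
  exact (mul_eq_zero.1 h).resolve_left (by positivity)

/-- Inversion of the expansion in powers of `X / (1 - X) ^ 2`. -/
theorem coeff_mul_of_shadow_expansion {K i : ℕ} (hi : i ≤ K) (d : ℕ → ℝ) :
    coeff (K - i) ((∑ j ∈ range (K + 1), C (d j) * (X ^ (K - j) * (1 - X) ^ (2 * j))) *
      ((1 + X) * (1 - X)⁻¹ ^ (2 * i + 1))) = d i := by
  rw [Finset.sum_mul, map_sum, Finset.sum_eq_single_of_mem i (Finset.mem_range.2 (by omega))]
  · have h : C (d i) * (X ^ (K - i) * (1 - X) ^ (2 * i)) * ((1 + X) * (1 - X)⁻¹ ^ (2 * i + 1)) =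
        C (d i) * (X ^ (K - i) * ((1 + X) * (1 - X)⁻¹)) := by
      have hw : (1 - X : ℝ⟦X⟧)⁻¹ ^ (2 * i) * (1 - X) ^ (2 * i) = 1 := by
        rw [← mul_pow, one_sub_X_inv_mul, one_pow]
      linear_combination (C (d i) * (X ^ (K - i) * ((1 + X) * (1 - X)⁻¹))) * hw
    rw [h, coeff_C_mul, coeff_X_pow_mul' _ _ (K - i), if_pos le_rfl]
    simp
  -- Terms with j < i start beyond degree K - i; those with j > i vanish by the residue argument.
  · intro j hj hji
    have hj := Finset.mem_range.1 hj
    rw [mul_assoc, coeff_C_mul, mul_assoc, coeff_X_pow_mul']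
    split_ifs with hle
    · obtain ⟨k, rfl⟩ : ∃ k, j = i + (k + 1) := ⟨j - i - 1, by omega⟩
      have h : (1 - X : ℝ⟦X⟧) ^ (2 * (i + (k + 1))) * ((1 + X) * (1 - X)⁻¹ ^ (2 * i + 1)) =
          (1 - X) ^ (2 * k + 1) * (1 + X) := by
        have hw : (1 - X : ℝ⟦X⟧)⁻¹ ^ (2 * i + 1) * (1 - X) ^ (2 * i + 1) = 1 := by
          rw [← mul_pow, one_sub_X_inv_mul, one_pow]
        rw [show 2 * (i + (k + 1)) = (2 * i + 1) + (2 * k + 1) by ring, pow_add]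
        linear_combination ((1 - X) ^ (2 * k + 1) * (1 + X)) * hw
      rw [h, show K - i - (K - (i + (k + 1))) = k + 1 by omega, coeff_one_sub_X_pow_mul, mul_zero]
    · rw [mul_zero]

/-- Inversion of the expansion in powers of `X (1 - X) ^ 2 / (1 + X) ^ 4`. -/
theorem coeff_mul_of_code_expansion {N K i : ℕ} (hN : 4 * K ≤ N) (hi : i ≤ K) (c : ℕ → ℝ) :
    coeff i ((∑ j ∈ range (K + 1), C (c j) * (X ^ j * ((1 + X) ^ (N - 4 * j) * (1 - X) ^ (2 * j)))) *
      ((1 + X)⁻¹ ^ (N + 1 - 4 * i) * (1 - 6 * X + X ^ 2) * (1 - X)⁻¹ ^ (2 * i + 1))) = c i := by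
  rw [Finset.sum_mul, map_sum, Finset.sum_eq_single_of_mem i (Finset.mem_range.2 (by omega))]
  · have hw : (1 - X : ℝ⟦X⟧)⁻¹ ^ (2 * i) * (1 - X) ^ (2 * i) = 1 := by
      rw [← mul_pow, one_sub_X_inv_mul, one_pow]
    have hu : (1 + X : ℝ⟦X⟧)⁻¹ ^ (N - 4 * i) * (1 + X) ^ (N - 4 * i) = 1 := by
      rw [← mul_pow, one_add_X_inv_mul, one_pow]
    have h : (1 + X : ℝ⟦X⟧) ^ (N - 4 * i) * (1 - X) ^ (2 * i) * ((1 + X)⁻¹ ^ (N + 1 - 4 * i) *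
        (1 - 6 * X + X ^ 2) * (1 - X)⁻¹ ^ (2 * i + 1)) =
        (1 + X)⁻¹ * (1 - 6 * X + X ^ 2) * (1 - X)⁻¹ := by
      rw [show N + 1 - 4 * i = (N - 4 * i) + 1 by omega, pow_succ (1 + X : ℝ⟦X⟧)⁻¹,
        pow_succ (1 - X : ℝ⟦X⟧)⁻¹]
      calc _ = ((1 - X : ℝ⟦X⟧)⁻¹ ^ (2 * i) * (1 - X) ^ (2 * i)) *
          ((1 + X : ℝ⟦X⟧)⁻¹ ^ (N - 4 * i) * (1 + X) ^ (N - 4 * i)) *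
          ((1 + X)⁻¹ * (1 - 6 * X + X ^ 2) * (1 - X)⁻¹) := by ring
        _ = _ := by rw [hw, hu]; ring
    rw [mul_assoc, coeff_C_mul, mul_assoc, h, coeff_X_pow_mul' _ _ i, if_pos le_rfl]
    simp
  -- Here terms with j > i start beyond degree i, and those with j < i vanish by the residue
  -- argument.
  · intro j hj hji
    have hj := Finset.mem_range.1 hj
    rw [mul_assoc, coeff_C_mul, mul_assoc, coeff_X_pow_mul']
    split_ifs with hle
    · obtain ⟨k, rfl⟩ : ∃ k, i = j + (k + 1) := ⟨i - j - 1, by omega⟩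
      obtain ⟨M, rfl⟩ : ∃ M, N = 4 * (j + (k + 1)) + M := ⟨N - 4 * (j + (k + 1)), by omega⟩
      have hw : (1 - X : ℝ⟦X⟧)⁻¹ ^ (2 * j) * (1 - X) ^ (2 * j) = 1 := by
        rw [← mul_pow, one_sub_X_inv_mul, one_pow]
      have hu : (1 + X : ℝ⟦X⟧)⁻¹ ^ (M + 1) * (1 + X) ^ (M + 1) = 1 := by
        rw [← mul_pow, one_add_X_inv_mul, one_pow]
      rw [show j + (k + 1) - j = k + 1 by omega,
        show 4 * (j + (k + 1)) + M - 4 * j = (M + 1) + (4 * k + 3) by omega,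
        show 4 * (j + (k + 1)) + M + 1 - 4 * (j + (k + 1)) = M + 1 by omega,
        show 2 * (j + (k + 1)) + 1 = 2 * j + (2 * k + 3) by ring, pow_add (1 + X : ℝ⟦X⟧) (M + 1),
        pow_add (1 - X : ℝ⟦X⟧)⁻¹ (2 * j)]
      have h : (1 + X : ℝ⟦X⟧) ^ (M + 1) * (1 + X) ^ (4 * k + 3) * (1 - X) ^ (2 * j) *
          ((1 + X)⁻¹ ^ (M + 1) * (1 - 6 * X + X ^ 2) * ((1 - X)⁻¹ ^ (2 * j) *
            (1 - X)⁻¹ ^ (2 * k + 3))) =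
          (1 + X) ^ (4 * k + 3) * (1 - 6 * X + X ^ 2) * (1 - X)⁻¹ ^ (2 * k + 3) := by
        calc _ = ((1 - X : ℝ⟦X⟧)⁻¹ ^ (2 * j) * (1 - X) ^ (2 * j)) *
            ((1 + X : ℝ⟦X⟧)⁻¹ ^ (M + 1) * (1 + X) ^ (M + 1)) *
            ((1 + X) ^ (4 * k + 3) * (1 - 6 * X + X ^ 2) * (1 - X)⁻¹ ^ (2 * k + 3)) := by ring
          _ = _ := by rw [hw, hu]; ring
      rw [h, coeff_one_add_X_pow_mul, mul_zero]
    · rw [mul_zero]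

theorem coeff_mul_of_eq_one {A : ℝ⟦X⟧} {i : ℕ} (h0 : coeff 0 A = 1)
    (hA : ∀ j, 1 ≤ j → j ≤ i → coeff j A = 0) (G : ℝ⟦X⟧) : coeff i (A * G) = coeff i G := by
  have hdvd : X ^ (i + 1) ∣ A - 1 := by
    rw [X_pow_dvd_iff]
    intro j hj
    rcases Nat.eq_zero_or_pos j with rfl | hpos
    · rw [map_sub, h0]; simp
    · rw [map_sub, hA j hpos (by omega), coeff_one, if_neg (by omega), sub_zero]
  obtain ⟨F, hF⟩ := hdvd
  rw [show A = 1 + X ^ (i + 1) * F by rw [← hF]; ring, add_mul, one_mul, map_add, mul_assoc,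
    coeff_X_pow_mul', if_neg (by omega), add_zero]

/-- The Bürmann–Lagrange form of the coefficients of the expansion of `1`. -/
theorem mul_coeff_code_kernel {N i : ℕ} (hi : 1 ≤ i) (hN : 4 * i ≤ N) :
    (i : ℝ) * coeff i ((1 + X : ℝ⟦X⟧)⁻¹ ^ (N + 1 - 4 * i) * (1 - 6 * X + X ^ 2) *
      (1 - X)⁻¹ ^ (2 * i + 1)) =
    -((N : ℝ) * coeff (i - 1) ((1 + X : ℝ⟦X⟧)⁻¹ ^ (N + 1 - 4 * i) * (1 - X)⁻¹ ^ (2 * i))) := by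
  obtain ⟨M, rfl⟩ : ∃ M, N = 4 * i + M := ⟨N - 4 * i, by omega⟩
  rw [show 4 * i + M + 1 - 4 * i = M + 1 by omega]
  -- For F = (1 + X)^(-M) (1 - X)^(-2i), the i-th coefficients of X F' and i F agree; the difference
  -- of these series consists of the two sides of the claim.
  have h := coeff_X_mul_derivative ((1 + X : ℝ⟦X⟧)⁻¹ ^ M * (1 - X)⁻¹ ^ (2 * i)) i
  have hid : X * d⁄dX ℝ ((1 + X : ℝ⟦X⟧)⁻¹ ^ M * (1 - X)⁻¹ ^ (2 * i)) =
      (i : ℝ⟦X⟧) * ((1 + X : ℝ⟦X⟧)⁻¹ ^ M * (1 - X)⁻¹ ^ (2 * i)) -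
      (i : ℝ⟦X⟧) * ((1 + X : ℝ⟦X⟧)⁻¹ ^ (M + 1) * (1 - 6 * X + X ^ 2) * (1 - X)⁻¹ ^ (2 * i + 1)) -
      ((4 * i + M : ℕ) : ℝ⟦X⟧) * (X * ((1 + X : ℝ⟦X⟧)⁻¹ ^ (M + 1) * (1 - X)⁻¹ ^ (2 * i))) := by
    rw [Derivation.leibniz, derivative_one_sub_X_inv_pow, derivative_one_add_X_inv_pow]
    have hw : (1 - X : ℝ⟦X⟧)⁻¹ ^ (2 * i) = (1 - X)⁻¹ ^ (2 * i + 1) * (1 - X) := by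
      rw [pow_succ _ (2 * i), mul_assoc, one_sub_X_inv_mul, mul_one]
    have hu : (1 + X : ℝ⟦X⟧)⁻¹ ^ M = (1 + X)⁻¹ ^ (M + 1) * (1 + X) := by
      rw [pow_succ _ M, mul_assoc, one_add_X_inv_mul, mul_one]
    simp only [smul_eq_mul]
    rw [hw, hu]
    push_cast
    ring
  have hX : coeff i (X * ((1 + X : ℝ⟦X⟧)⁻¹ ^ (M + 1) * (1 - X)⁻¹ ^ (2 * i))) =
      coeff (i - 1) ((1 + X : ℝ⟦X⟧)⁻¹ ^ (M + 1) * (1 - X)⁻¹ ^ (2 * i)) := by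
    conv_lhs => rw [← Nat.sub_add_cancel hi, coeff_succ_X_mul]
    rw [Nat.sub_add_cancel hi]
  rw [hid, map_sub, map_sub, coeff_natCast_mul, coeff_natCast_mul, coeff_natCast_mul, hX] at h
  linarith

/-- The power series `(1 - X ^ 2) ^ (-q)`. -/
noncomputable def invOneSubSqPow (q : ℕ) : ℝ⟦X⟧ := expand 2 two_ne_zero ((1 - X)⁻¹ ^ q)

theorem invOneSubSqPow_eq (q : ℕ) :
    invOneSubSqPow q = (1 + X)⁻¹ ^ q * (1 - X)⁻¹ ^ q := by
  have h1 : invOneSubSqPow q * ((1 + X) * (1 - X)) ^ q = 1 := by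
    have h := congrArg (expand 2 two_ne_zero)
      (show (1 - X : ℝ⟦X⟧)⁻¹ ^ q * (1 - X) ^ q = 1 by
        rw [← mul_pow, one_sub_X_inv_mul, one_pow])
    rw [map_mul, map_pow _ (1 - X), map_sub, map_one, expand_X] at h
    rw [show (1 + X : ℝ⟦X⟧) * (1 - X) = 1 - X ^ 2 by ring]
    exact h
  have h2 : ((1 + X : ℝ⟦X⟧) * (1 - X)) ^ q * ((1 + X)⁻¹ ^ q * (1 - X)⁻¹ ^ q) = 1 := by
    rw [← mul_pow, ← mul_pow]
    rw [show (1 + X : ℝ⟦X⟧) * (1 - X) * ((1 + X)⁻¹ * (1 - X)⁻¹) =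
      ((1 + X)⁻¹ * (1 + X)) * ((1 - X)⁻¹ * (1 - X)) by ring, one_add_X_inv_mul,
      one_sub_X_inv_mul, one_mul, one_pow]
  calc invOneSubSqPow q = invOneSubSqPow q * (((1 + X : ℝ⟦X⟧) * (1 - X)) ^ q *
        ((1 + X)⁻¹ ^ q * (1 - X)⁻¹ ^ q)) := by rw [h2, mul_one]
    _ = _ := by rw [← mul_assoc, h1, one_mul]

theorem coeff_invOneSubSqPow_two_mul (q k : ℕ) :
    coeff (2 * k) (invOneSubSqPow (q + 1)) = ((q + k).choose q : ℝ) := by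
  rw [invOneSubSqPow, coeff_expand_mul, coeff_one_sub_X_inv_pow]

theorem coeff_invOneSubSqPow_of_odd (q : ℕ) {k : ℕ} (hk : ¬ 2 ∣ k) :
    coeff k (invOneSubSqPow q) = 0 :=
  coeff_expand_of_not_dvd 2 two_ne_zero _ hk

end PowerSeries

/-! ### Gleason expansions of the code and its shadow -/

namespace BinaryCode

variable {n : ℕ}

theorem sum_words_eq_sum_weightCount (X : Set (Fin n → ZMod 2)) (f : ℕ → ℕ) (M : ℕ)
    (hf : ∀ x ∈ X, ∃ j < M, hammingNorm x = f j) (hinj : Function.Injective f) (g : ℕ → ℂ) :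
    ∑ x ∈ words X, g (hammingNorm x) = ∑ j ∈ range M, (weightCount X (f j) : ℂ) * g (f j) := by
  have hmaps : ∀ x ∈ words X, hammingNorm x ∈ (range M).image f := by
    intro x hx
    obtain ⟨j, hj, h⟩ := hf x (mem_words.1 hx)
    exact Finset.mem_image.2 ⟨j, Finset.mem_range.2 hj, h.symm⟩
  rw [← Finset.sum_fiberwise_of_maps_to hmaps, Finset.sum_image hinj.injOn]
  refine Finset.sum_congr rfl fun j _ => ?_
  rw [Finset.sum_congr rfl (g := fun _ => g (f j)), Finset.sum_const, nsmul_eq_mul]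
  · rfl
  · intro x hx
    rw [(Finset.mem_filter.1 hx).2]

theorem weightCount_eq_zero {X : Set (Fin n → ZMod 2)} {w : ℕ}
    (h : ∀ x ∈ X, hammingNorm x ≠ w) : weightCount X w = 0 := by
  rw [weightCount, Finset.card_eq_zero, Finset.filter_eq_empty_iff]
  exact fun x hx => h x (mem_words.1 hx)

/-- The weight enumerator of a code with even weights, in the variable `y ^ 2`. -/
noncomputable def codeSeries (C : BinaryCode n) : PowerSeries ℝ :=
  PowerSeries.mk fun j => (weightCount (C : Set (Fin n → ZMod 2)) (2 * j) : ℝ)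

/-- The generating series of the numbers of words of weight `r + 4j` in the shadow. -/
noncomputable def shadowSeries (C : BinaryCode n) (r : ℕ) : PowerSeries ℝ :=
  PowerSeries.mk fun j => (weightCount (shadow C) (r + 4 * j) : ℝ)

open PowerSeries in
theorem mk_eq_sum {a : ℕ → ℝ} {M : ℕ} (ha : ∀ j, M ≤ j → a j = 0) :
    (PowerSeries.mk a : ℝ⟦X⟧) = ∑ j ∈ range M, C (a j) * X ^ j := by
  ext k
  simp only [coeff_mk, map_sum, coeff_C_mul, coeff_X_pow]
  by_cases hk : k < M
  · rw [Finset.sum_eq_single_of_mem k (Finset.mem_range.2 hk)]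
    · simp
    · intro j _ hj
      rw [if_neg (Ne.symm hj), mul_zero]
  · rw [ha k (by omega), Finset.sum_eq_zero]
    intro j hj
    have := Finset.mem_range.1 hj
    rw [if_neg (by omega), mul_zero]

variable {C : BinaryCode n}

/-- Gleason's theorem for a self-dual code with nonempty shadow, together with the corresponding
expansion for the shadow. -/
theorem IsSelfDual.exists_expansions (hC : IsSelfDual C) (hS : (shadow C).Nonempty) {r K : ℕ}
    (hr : r < 4) (hn : n = 2 * (r + 4 * K)) :
    ∃ d : ℕ → ℝ,
      shadowSeries C r = ∑ j ∈ range (K + 1), PowerSeries.C (d j) *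
        (PowerSeries.X ^ (K - j) * (1 - PowerSeries.X) ^ (2 * j)) ∧
      codeSeries C = ∑ j ∈ range (K + 1), PowerSeries.C ((-64) ^ j * d j / 2 ^ (r + 4 * K)) *
        (PowerSeries.X ^ j * ((1 + PowerSeries.X) ^ (r + 4 * K - 4 * j) *
          (1 - PowerSeries.X) ^ (2 * j))) := by
  have hn2 : n / 2 = r + 4 * K := by omega
  have hform : ∀ x ∈ shadow C, ∃ j < 2 * K + 1, hammingNorm x = r + 4 * j := by
    intro x hx
    have h1 := hC.hammingNorm_mod_four hx
    have h2 := hammingNorm_le x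
    exact ⟨hammingNorm x / 4, by omega, by omega⟩
  have hcode : ∀ x ∈ (C : Set (Fin n → ZMod 2)), ∃ j < r + 4 * K + 1, hammingNorm x = 2 * j := by
    intro x hx
    obtain ⟨k, hk⟩ := hC.even_hammingNorm hx
    have h2 := hammingNorm_le x
    exact ⟨k, by omega, by omega⟩
  obtain ⟨d, hd⟩ := exists_expansion_of_palindromic K
    (fun j => (weightCount (shadow C) (r + 4 * j) : ℤ)) (by
      intro j hj
      rw [← hC.weightCount_shadow_sub (w := r + 4 * j) (by omega)]
      congr 2
      omega)
  refine ⟨fun j => d j, ?_, ?_⟩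
  -- The expansion holds over every commutative ring with the same d: here P = 1 and Q = X, below P
  -- = (1 - iy)^4 and Q = (1 + iy)^4 in ℂ.
  · have h := hd (PowerSeries ℝ) 1 PowerSeries.X
    rw [shadowSeries, mk_eq_sum (M := 2 * K + 1)]
    · simpa [mul_assoc] using h
    · intro j hj
      rw [Nat.cast_eq_zero]
      refine weightCount_eq_zero fun x _ hx => ?_
      have := hammingNorm_le x
      omega
  · have hpoly : (∑ j ∈ range (r + 4 * K + 1),
          Polynomial.C (weightCount (C : Set (Fin n → ZMod 2)) (2 * j) : ℝ) * Polynomial.X ^ j) =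
        ∑ j ∈ range (K + 1), Polynomial.C ((-64) ^ j * (d j : ℝ) / 2 ^ (r + 4 * K)) *
          (Polynomial.X ^ j * ((1 + Polynomial.X) ^ (r + 4 * K - 4 * j) *
            (1 - Polynomial.X) ^ (2 * j))) := by
      -- Agreement at all Y ≥ 0 suffices, and there Y = y² with y real.
      refine Polynomial.eq_of_infinite_eval_eq _ _ (Set.Infinite.mono ?_ (Set.Ici_infinite (0 : ℝ)))
      intro Y hY
      obtain ⟨y, rfl⟩ : ∃ y : ℝ, Y = y ^ 2 := ⟨√Y, (Real.sq_sqrt hY).symm⟩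
      simp only [Set.mem_ofPred_eq, Polynomial.eval_finsetSum, Polynomial.eval_mul,
        Polynomial.eval_C, Polynomial.eval_pow, Polynomial.eval_X, Polynomial.eval_add,
        Polynomial.eval_sub, Polynomial.eval_one]
      have h := hC.sum_shadow_eq hS y
      rw [sum_words_eq_sum_weightCount (shadow C) (fun j => r + 4 * j) (2 * K + 1) hform
          (fun a b h => by simpa using h)
          (fun w => (1 - Complex.I * y) ^ (n - w) * (1 + Complex.I * y) ^ w),
        sum_words_eq_sum_weightCount (C : Set (Fin n → ZMod 2)) (fun j => 2 * j)
          (r + 4 * K + 1) hcode (fun a b h => by simpa using h) (fun w => (y : ℂ) ^ w), hn2] at h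
      have hI := Complex.I_sq
      have hPQ : (1 - Complex.I * y) * (1 + Complex.I * y) = 1 + (y : ℂ) ^ 2 := by
        linear_combination (-(y : ℂ) ^ 2) * hI
      -- Source of the factor -64: (P - Q)² = -64 Y (1 - Y)², while PQ = (1 + Y)^4.
      have hdiff : ((1 - Complex.I * (y : ℂ)) ^ 4 - (1 + Complex.I * y) ^ 4) ^ 2 =
          -64 * ((y : ℂ) ^ 2 * (1 - (y : ℂ) ^ 2) ^ 2) := by
        have h1 : (1 - Complex.I * (y : ℂ)) ^ 4 - (1 + Complex.I * y) ^ 4 =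
            -8 * Complex.I * y * (1 - (y : ℂ) ^ 2) := by
          linear_combination (-8 * Complex.I * (y : ℂ) ^ 3) * hI
        rw [h1]
        linear_combination (64 * (y : ℂ) ^ 2 * (1 - (y : ℂ) ^ 2) ^ 2) * hI
      have hleft : ∑ j ∈ range (2 * K + 1), (weightCount (shadow C) (r + 4 * j) : ℂ) *
          ((1 - Complex.I * y) ^ (n - (r + 4 * j)) * (1 + Complex.I * y) ^ (r + 4 * j)) =
          ∑ j ∈ range (K + 1), (d j : ℂ) * (-64) ^ j * (((y : ℂ) ^ 2) ^ j *
            ((1 + (y : ℂ) ^ 2) ^ (r + 4 * K - 4 * j) * (1 - (y : ℂ) ^ 2) ^ (2 * j))) := by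
        have h2 := hd ℂ ((1 - Complex.I * y) ^ 4) ((1 + Complex.I * y) ^ 4)
        calc _ = (1 + (y : ℂ) ^ 2) ^ r * ∑ j ∈ range (2 * K + 1),
              (((weightCount (shadow C) (r + 4 * j) : ℤ)) : ℂ) *
                ((1 - Complex.I * y) ^ 4) ^ (2 * K - j) * ((1 + Complex.I * y) ^ 4) ^ j := by
              rw [Finset.mul_sum]
              refine Finset.sum_congr rfl fun j hj => ?_
              have hj := Finset.mem_range.1 hj
              rw [← hPQ, show n - (r + 4 * j) = r + 4 * (2 * K - j) by omega, pow_add, pow_add,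
                mul_pow, pow_mul, pow_mul, Int.cast_natCast]
              ring
          _ = _ := by
              rw [h2, Finset.mul_sum]
              refine Finset.sum_congr rfl fun j hj => ?_
              have hj := Finset.mem_range.1 hj
              rw [← mul_pow, hPQ, pow_mul _ 2 j, hdiff, ← pow_mul, mul_pow, mul_pow, ← pow_mul,
                ← pow_mul, show r + 4 * K - 4 * j = r + 4 * (K - j) by omega, pow_add]
              ring
      rw [hleft] at h
      have h2N : (2 : ℝ) ^ (r + 4 * K) ≠ 0 := by positivity
      have hreal : ∑ j ∈ range (K + 1), (d j : ℝ) * (-64) ^ j * ((y ^ 2) ^ j *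
            ((1 + y ^ 2) ^ (r + 4 * K - 4 * j) * (1 - y ^ 2) ^ (2 * j))) =
          2 ^ (r + 4 * K) * ∑ j ∈ range (r + 4 * K + 1),
            (weightCount (C : Set (Fin n → ZMod 2)) (2 * j) : ℝ) * y ^ (2 * j) := by
        exact_mod_cast h
      simp only [← pow_mul y]
      refine mul_left_cancel₀ h2N (hreal.symm.trans ?_)
      rw [Finset.mul_sum]
      refine Finset.sum_congr rfl fun j _ => ?_
      field_simp
      ring
    have hps := congrArg (Polynomial.coeToPowerSeries.ringHom (R := ℝ)) hpoly
    simp only [map_sum, map_mul, map_pow, map_add, map_sub, map_one,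
      Polynomial.coeToPowerSeries.ringHom_apply, Polynomial.coe_C, Polynomial.coe_X] at hps
    rw [← hps, codeSeries, mk_eq_sum]
    intro j hj
    rw [Nat.cast_eq_zero]
    refine weightCount_eq_zero fun x _ hx => ?_
    have := hammingNorm_le x
    omega

/-! ### Consequences of a large minimum weight -/

theorem IsMinWeight.weightCount_eq_zero {d w : ℕ} (h : IsMinWeight C d) (hw : w ≠ 0)
    (hwd : w < d) : weightCount (C : Set (Fin n → ZMod 2)) w = 0 := by
  refine BinaryCode.weightCount_eq_zero fun x hx hxw => ?_
  have := h.2 ⟨x, hx, hammingNorm_ne_zero_iff.1 (hxw ▸ hw), hxw⟩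
  omega

theorem weightCount_zero : weightCount (C : Set (Fin n → ZMod 2)) 0 = 1 := by
  rw [weightCount, Finset.card_eq_one]
  refine ⟨0, ?_⟩
  ext x
  simp only [Finset.mem_filter, mem_words, hammingNorm_eq_zero, Finset.mem_singleton]
  exact ⟨fun h => h.2, fun h => ⟨by rw [h]; exact C.zero_mem, h⟩⟩

theorem weightCount_pos {X : Set (Fin n → ZMod 2)} {x : Fin n → ZMod 2} (hx : x ∈ X) :
    0 < weightCount X (hammingNorm x) :=
  Finset.card_pos.2 ⟨x, Finset.mem_filter.2 ⟨mem_words.2 hx, rfl⟩⟩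

/-- The sum of two shadow words is a codeword of weight at most the sum of their weights, hence
zero. -/
theorem IsSelfDual.eq_of_hammingNorm_add_lt (hC : IsSelfDual C) {d : ℕ} (hd : IsMinWeight C d)
    {s x : Fin n → ZMod 2} (hs : s ∈ shadow C) (hx : x ∈ shadow C)
    (h : hammingNorm s + hammingNorm x < d) : x = s := by
  by_contra hne
  have h0 : s + x ≠ 0 := fun h0 => hne (by
    rw [← add_zero x, ← word_add_self s, add_comm s s, ← add_assoc, add_comm x s, h0, zero_add])
  have h1 := hd.2 ⟨s + x, hC.add_mem_of_mem_shadow hs hx, h0, rfl⟩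
  have h2 := hammingNorm_add_add s x
  omega

/-- If the minimum weight of the code is large, then a word of small weight in the shadow is the
only word of the shadow of comparable weight. -/
theorem IsSelfDual.weightCount_shadow_eq_ite (hC : IsSelfDual C) {d : ℕ} (hd : IsMinWeight C d)
    {s : Fin n → ZMod 2} (hs : s ∈ shadow C) {w : ℕ} (hw : hammingNorm s + w < d) :
    weightCount (shadow C) w = if w = hammingNorm s then 1 else 0 := by
  split_ifs with h
  · subst h
    rw [weightCount, Finset.card_eq_one]
    refine ⟨s, ?_⟩
    ext x
    simp only [Finset.mem_filter, mem_words, Finset.mem_singleton]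
    constructor
    · rintro ⟨hx, hxw⟩
      exact hC.eq_of_hammingNorm_add_lt hd hs hx (by omega)
    · rintro rfl
      exact ⟨hs, rfl⟩
  · refine BinaryCode.weightCount_eq_zero fun x hx hxw => h ?_
    rw [← hxw, hC.eq_of_hammingNorm_add_lt hd hs hx (by omega)]

open PowerSeries in
/-- The two evaluations of the `i`-th coefficient in Gleason's theorem, for a code with minimum
weight larger than `2i`. -/
theorem IsSelfDual.coeff_shadowSeries (hC : IsSelfDual C) (hS : (shadow C).Nonempty) {r K i d : ℕ}
    (hr : r < 4) (hn : n = 2 * (r + 4 * K)) (hd : IsMinWeight C d) (hi : 1 ≤ i) (hiK : i ≤ K)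
    (hid : 2 * i < d) :
    (i : ℝ) * (-64) ^ i *
        coeff (K - i) (shadowSeries C r * ((1 + X) * (1 - X)⁻¹ ^ (2 * i + 1))) =
      -(2 ^ (r + 4 * K) * ((r + 4 * K : ℕ) : ℝ) * coeff (i - 1)
        ((1 + X : ℝ⟦X⟧)⁻¹ ^ (r + 4 * K + 1 - 4 * i) * (1 - X)⁻¹ ^ (2 * i))) := by
  obtain ⟨e, he1, he2⟩ := hC.exists_expansions hS hr hn
  have h1 := coeff_mul_of_shadow_expansion hiK e
  rw [← he1] at h1
  have h2 := coeff_mul_of_code_expansion (N := r + 4 * K) (by omega) hiK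
    (fun j => (-64) ^ j * e j / 2 ^ (r + 4 * K))
  -- Since 2i < d, the code series is 1 through degree i and drops out.
  rw [← he2, coeff_mul_of_eq_one] at h2
  · have h3 := mul_coeff_code_kernel (N := r + 4 * K) hi (by omega)
    rw [h2] at h3
    rw [h1]
    have h2N : (2 : ℝ) ^ (r + 4 * K) ≠ 0 := by positivity
    field_simp at h3
    linarith
  · simp [codeSeries, weightCount_zero]
  · intro j hj hji
    rw [codeSeries, coeff_mk, hd.weightCount_eq_zero (by omega) (by omega), Nat.cast_zero]

open PowerSeries in
theorem coeff_one_add_X_mul_pow {q : ℕ} (hq : 1 ≤ q) (k : ℕ) :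
    coeff k ((1 + X : ℝ⟦X⟧) * (1 - X)⁻¹ ^ (q + 1)) =
      (((q + k).choose q + (q + k - 1).choose q : ℕ) : ℝ) := by
  rw [add_mul, one_mul, map_add, coeff_one_sub_X_inv_pow]
  cases k with
  -- With truncated subtraction the second binomial is `(q - 1).choose q`, which is 0 because q ≥ 1.
  | zero => simp [Nat.choose_eq_zero_of_lt (show q - 1 < q by omega)]
  | succ k =>
    rw [coeff_succ_X_mul, coeff_one_sub_X_inv_pow]
    push_cast
    rfl

open PowerSeries in
/-- The case in which the shadow has a unique word of small weight. -/
theorem IsSelfDual.choose_identity (hC : IsSelfDual C) {s : Fin n → ZMod 2} (hs : s ∈ shadow C)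
    {r K i d : ℕ} (hsr : hammingNorm s = r) (hr : r < 4) (hn : n = 2 * (r + 4 * K))
    (hd : IsMinWeight C d) (hi : 1 ≤ i) (hiK : i ≤ K) (hid : 2 * i < d)
    (hrd : 2 * r + 4 * (K - i) < d) :
    (i : ℝ) * (-64) ^ i *
        (((2 * i + (K - i)).choose (2 * i) + (2 * i + (K - i) - 1).choose (2 * i) : ℕ) : ℝ) =
      -(2 ^ (r + 4 * K) * ((r + 4 * K : ℕ) : ℝ) * coeff (i - 1)
        ((1 + X : ℝ⟦X⟧)⁻¹ ^ (r + 4 * K + 1 - 4 * i) * (1 - X)⁻¹ ^ (2 * i))) := by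
  have h := hC.coeff_shadowSeries ⟨s, hs⟩ hr hn hd hi hiK hid
  rw [coeff_mul_of_eq_one, coeff_one_add_X_mul_pow (by omega)] at h
  · exact h
  · rw [shadowSeries, coeff_mk, hC.weightCount_shadow_eq_ite hd hs (by omega), if_pos (by omega),
      Nat.cast_one]
  · intro j hj hji
    rw [shadowSeries, coeff_mk, hC.weightCount_shadow_eq_ite hd hs (by omega), if_neg (by omega),
      Nat.cast_zero]

end BinaryCode

/-! ### The individual lengths -/

namespace BinaryCode

variable {n : ℕ} {C : BinaryCode n}

/-- A self-dual code of length `2`, `4` or `6` with nonempty shadow has words of weight two. -/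
theorem IsSelfDual.not_isMinWeight_of_length_lt_eight (hC : IsSelfDual C)
    (hS : (shadow C).Nonempty) {r d : ℕ} (hr0 : 0 < r) (hr : r < 4) (hn : n = 2 * r)
    (hd : 2 < d) : ¬ IsMinWeight C d := by
  intro h
  -- With K = 0 the code enumerator is a constant times (1 + Y)^r; its constant term is 1, so there
  -- are r > 0 words of weight 2.
  obtain ⟨e, -, he⟩ := hC.exists_expansions hS (K := 0) hr (by omega)
  simp only [zero_add, Finset.sum_range_one, pow_zero, mul_zero, Nat.sub_zero, mul_one, one_mul,
    add_zero] at he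
  rw [show (1 + PowerSeries.X : PowerSeries ℝ) ^ r = (((1 + Polynomial.X) ^ r : Polynomial ℝ) :
    PowerSeries ℝ) by simp] at he
  have h0 := congrArg (PowerSeries.coeff 0) he
  have h1 := congrArg (PowerSeries.coeff 1) he
  rw [PowerSeries.coeff_C_mul, Polynomial.coeff_coe, Polynomial.coeff_one_add_X_pow, codeSeries,
    PowerSeries.coeff_mk] at h0 h1
  rw [mul_zero, weightCount_zero, Nat.choose_zero_right] at h0
  rw [h.weightCount_eq_zero (by omega) (by omega), Nat.choose_one_right] at h1
  have hr' : (r : ℝ) ≠ 0 := by exact_mod_cast hr0.ne'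
  rcases mul_eq_zero.1 (h1.symm.trans Nat.cast_zero) with h2 | h2
  · rw [h2] at h0; simp at h0
  · exact hr' h2

theorem neg_sixtyFour_pow_two_mul (m : ℕ) : (-64 : ℝ) ^ (2 * m) = 2 ^ (12 * m) := by
  rw [pow_mul, pow_mul]
  norm_num

theorem neg_sixtyFour_pow_two_mul_add_one (m : ℕ) :
    (-64 : ℝ) ^ (2 * m + 1) = -(64 * 2 ^ (12 * m)) := by
  rw [pow_succ, neg_sixtyFour_pow_two_mul]
  ring

open PowerSeries in
theorem IsSelfDual.not_isMinWeight_of_length_eq_add_twentyTwo (hC : IsSelfDual C) {m : ℕ}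
    {s : Fin n → ZMod 2} (hs : s ∈ shadow C) (hw : hammingNorm s = 3) (hn : n = 24 * m + 22) :
    ¬ IsMinWeight C (4 * m + 6) := by
  intro hd
  -- Here 2r + 4(K - i) equals the minimum weight, so uniqueness of light shadow words just fails.
  -- Instead, this i makes both exponents on the code side 2i: the series is even and its
  -- coefficient of odd index i - 1 vanishes.
  have h := hC.coeff_shadowSeries ⟨s, hs⟩ (r := 3) (K := 3 * m + 2) (i := 2 * m + 2) (by norm_num)
    (by omega) hd (by omega) (by omega) (by omega)
  rw [show 3 + 4 * (3 * m + 2) + 1 - 4 * (2 * m + 2) = 2 * (2 * m + 2) by omega,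
    ← invOneSubSqPow_eq, coeff_invOneSubSqPow_of_odd _ (by omega), mul_zero, neg_zero,
    show 2 * m + 2 = 2 * (m + 1) by ring, neg_sixtyFour_pow_two_mul] at h
  refine absurd h (mul_pos (mul_pos (by positivity) (by positivity)) ?_).ne'
  -- All terms of the convolution are nonnegative, and the one containing s is positive.
  rw [coeff_mul]
  refine Finset.sum_pos' ?_ ⟨(0, 3 * m + 2 - 2 * (m + 1)), by simp, ?_⟩
  · intro p _
    rw [coeff_one_add_X_mul_pow (by omega), shadowSeries, coeff_mk]
    positivity
  · rw [coeff_one_add_X_mul_pow (by omega), shadowSeries, coeff_mk]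
    have h1 : 0 < weightCount (shadow C) (3 + 4 * 0) := by
      rw [show 3 + 4 * 0 = hammingNorm s by omega]
      exact weightCount_pos hs
    have h2 : 0 < (2 * (2 * (m + 1)) + (3 * m + 2 - 2 * (m + 1))).choose (2 * (2 * (m + 1))) :=
      Nat.choose_pos (by omega)
    exact mul_pos (by exact_mod_cast h1) (by exact_mod_cast Nat.add_pos_left h2 _)

open PowerSeries in
theorem IsSelfDual.not_isMinWeight_of_length_eq_add_ten (hC : IsSelfDual C) {m : ℕ}
    {s : Fin n → ZMod 2} (hs : s ∈ shadow C) (hw : hammingNorm s = 1) (hn : n = 24 * m + 10) :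
    ¬ IsMinWeight C (4 * m + 4) := by
  intro hd
  have h := hC.choose_identity hs hw (K := 3 * m + 1) (i := 2 * m + 1) (by norm_num)
    (by omega) hd (by omega) (by omega) (by omega) (by omega)
  rw [show 1 + 4 * (3 * m + 1) + 1 - 4 * (2 * m + 1) = (4 * m + 1) + 1 by omega,
    show 2 * (2 * m + 1) = (4 * m + 1) + 1 by ring, ← invOneSubSqPow_eq,
    show 2 * m + 1 - 1 = 2 * m by omega, coeff_invOneSubSqPow_two_mul,
    neg_sixtyFour_pow_two_mul_add_one,
    show 1 + 4 * (3 * m + 1) = 12 * m + 5 by ring, pow_add,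
    show 4 * m + 1 + 1 + (3 * m + 1 - (2 * m + 1)) = 5 * m + 2 by omega,
    show 5 * m + 2 - 1 = 5 * m + 1 by omega, show 4 * m + 1 + m = 5 * m + 1 by ring] at h
  have h1 : (5 * m + 2) * (5 * m + 1).choose (4 * m + 1) =
      (5 * m + 2).choose (4 * m + 1 + 1) * (4 * m + 2) :=
    Nat.add_one_mul_choose_eq (5 * m + 1) (4 * m + 1)
  have h2 := Nat.choose_succ_right_eq (5 * m + 1) (4 * m + 1)
  rw [show 5 * m + 1 - (4 * m + 1) = m by omega] at h2
  have hpos : 0 < (5 * m + 1).choose (4 * m + 1) := Nat.choose_pos (by omega)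
  generalize (5 * m + 1).choose (4 * m + 1) = c at *
  generalize (5 * m + 2).choose (4 * m + 1 + 1) = a at *
  generalize (5 * m + 1).choose (4 * m + 1 + 1) = b at *
  have h3 : ((2 * m + 1) * 64 * (a + b) : ℝ) = 32 * (12 * m + 5) * c := by
    have hpow : (2 : ℝ) ^ (12 * m) ≠ 0 := by positivity
    push_cast at h
    apply mul_left_cancel₀ hpow
    linear_combination -h
  have h4 : (2 * m + 1) * 64 * (a + b) = 32 * (12 * m + 5) * c := by exact_mod_cast h3
  -- The relations give (4m + 2)(a + b) = (6m + 2)c, whereas the identity demands (12m + 5)c.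
  nlinarith

open PowerSeries in
theorem IsSelfDual.not_isMinWeight_of_length_eq_add_two (hC : IsSelfDual C) {p : ℕ}
    {s : Fin n → ZMod 2} (hs : s ∈ shadow C) (hw : hammingNorm s = 1)
    (hn : n = 24 * (p + 1) + 2) : ¬ IsMinWeight C (4 * (p + 1) + 4) := by
  intro hd
  have h := hC.choose_identity hs hw (K := 3 * (p + 1)) (i := 2 * (p + 1)) (by norm_num)
    (by omega) hd (by omega) (by omega) (by omega) (by omega)
  -- Equalising the exponents leaves the numerator (1 - X)² over a power of 1 - X²; at an odd index
  -- only its term -2X contributes.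
  have hser : (1 + X : ℝ⟦X⟧)⁻¹ ^ (4 * p + 6) * (1 - X)⁻¹ ^ (4 * p + 4) =
      (1 - 2 * X + X ^ 2) * invOneSubSqPow (4 * p + 5 + 1) := by
    rw [invOneSubSqPow_eq]
    have hw2 : (1 - X : ℝ⟦X⟧)⁻¹ ^ 2 * (1 - X) ^ 2 = 1 := by
      rw [← mul_pow, one_sub_X_inv_mul, one_pow]
    rw [show 4 * p + 5 + 1 = (4 * p + 4) + 2 by ring, pow_add (1 - X : ℝ⟦X⟧)⁻¹]
    linear_combination (-(1 + X : ℝ⟦X⟧)⁻¹ ^ (4 * p + 6) * (1 - X)⁻¹ ^ (4 * p + 4)) * hw2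
  have hcoeff : coeff (2 * p + 1) ((1 - 2 * X + X ^ 2) * invOneSubSqPow (4 * p + 5 + 1)) =
      -2 * ((5 * p + 5).choose (4 * p + 5) : ℝ) := by
    rw [show (1 - 2 * X + X ^ 2) * invOneSubSqPow (4 * p + 5 + 1) =
      invOneSubSqPow (4 * p + 5 + 1) - ((2 : ℕ) : ℝ⟦X⟧) * (X * invOneSubSqPow (4 * p + 5 + 1)) +
        X ^ 2 * invOneSubSqPow (4 * p + 5 + 1) by push_cast; ring]
    rw [map_add, map_sub, coeff_natCast_mul, coeff_succ_X_mul, coeff_invOneSubSqPow_two_mul,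
      coeff_invOneSubSqPow_of_odd _ (by omega), coeff_X_pow_mul']
    rw [show 4 * p + 5 + p = 5 * p + 5 by ring]
    split_ifs with hle
    · rw [coeff_invOneSubSqPow_of_odd _ (by omega)]
      push_cast
      ring
    · push_cast
      ring
  rw [show 1 + 4 * (3 * (p + 1)) + 1 - 4 * (2 * (p + 1)) = 4 * p + 6 by omega,
    show 2 * (2 * (p + 1)) = 4 * p + 4 by ring, hser,
    show 2 * (p + 1) - 1 = 2 * p + 1 by omega, hcoeff,
    neg_sixtyFour_pow_two_mul,
    show 1 + 4 * (3 * (p + 1)) = 12 * (p + 1) + 1 by ring, pow_succ,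
    show 4 * p + 4 + (3 * (p + 1) - 2 * (p + 1)) = 5 * p + 5 by omega,
    show 5 * p + 5 - 1 = 5 * p + 4 by omega] at h
  have h1 := Nat.choose_succ_right_eq (5 * p + 5) (4 * p + 4)
  rw [show 5 * p + 5 - (4 * p + 4) = p + 1 by omega, show 4 * p + 4 + 1 = 4 * p + 5 by ring] at h1
  have h2 := Nat.choose_mul_succ_eq (5 * p + 4) (4 * p + 4)
  rw [show 5 * p + 4 + 1 - (4 * p + 4) = p + 1 by omega,
    show 5 * p + 4 + 1 = 5 * p + 5 by ring] at h2
  have hpos : 0 < (5 * p + 4).choose (4 * p + 4) := Nat.choose_pos (by omega)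
  generalize (5 * p + 5).choose (4 * p + 4) = a at *
  generalize (5 * p + 4).choose (4 * p + 4) = b at *
  generalize (5 * p + 5).choose (4 * p + 5) = c at *
  have h3 : ((2 * (p + 1)) * (a + b) : ℝ) = 4 * (12 * (p + 1) + 1) * c := by
    have hpow : (2 : ℝ) ^ (12 * (p + 1)) ≠ 0 := by positivity
    push_cast at h
    apply mul_left_cancel₀ hpow
    linear_combination h
  have h4 : (2 * (p + 1)) * (a + b) = 4 * (12 * (p + 1) + 1) * c := by exact_mod_cast h3
  have h5 : a = 5 * b := by
    apply Nat.eq_of_mul_eq_mul_right (Nat.succ_pos p)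
    rw [Nat.succ_eq_add_one, ← h2]
    ring
  subst h5
  have h6 : (4 * p + 5) * (12 * (p + 1) * b) = 4 * (12 * (p + 1) + 1) * (5 * b * (p + 1)) := by
    rw [← h1]
    linear_combination (4 * p + 5) * h4
  have h7 : 0 < (p + 1) * b := by positivity
  -- After cancelling (p + 1)b the equation would be 12(4p + 5) = 20(12p + 13).
  nlinarith

/-- Relations between the binomial coefficients in the lengths `24m + 4` and `24m + 6`. -/
theorem choose_relations (p : ℕ) :
    (p + 1) * (5 * p + 6).choose (4 * p + 5) = (5 * p + 6) * (5 * p + 5).choose (4 * p + 5) ∧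
    (4 * p + 6) * ((5 * p + 6).choose (4 * p + 6) + (5 * p + 5).choose (4 * p + 6)) =
      6 * (p + 1) * (5 * p + 5).choose (4 * p + 5) := by
  have h1 := Nat.choose_mul_succ_eq (5 * p + 5) (4 * p + 5)
  rw [show 5 * p + 5 + 1 - (4 * p + 5) = p + 1 by omega] at h1
  have h2 := Nat.add_one_mul_choose_eq (5 * p + 5) (4 * p + 5)
  have h3 := Nat.choose_succ_right_eq (5 * p + 5) (4 * p + 5)
  rw [show 5 * p + 5 - (4 * p + 5) = p by omega] at h3
  simp only [add_assoc, Nat.reduceAdd] at h1 h2 h3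
  constructor
  · linarith
  · linarith

open PowerSeries in
theorem IsSelfDual.not_isMinWeight_of_length_eq_add_four (hC : IsSelfDual C) {p : ℕ}
    {s : Fin n → ZMod 2} (hs : s ∈ shadow C) (hw : hammingNorm s = 2)
    (hn : n = 24 * (p + 1) + 4) : ¬ IsMinWeight C (4 * (p + 1) + 4) := by
  intro hd
  have h := hC.choose_identity hs hw (K := 3 * (p + 1)) (i := 2 * (p + 1) + 1) (by norm_num)
    (by omega) hd (by omega) (by omega) (by omega) (by omega)
  -- The numerator is now (1 + X)³; the even index selects 1 + 3X².
  have hser : (1 + X : ℝ⟦X⟧)⁻¹ ^ (4 * p + 3) * (1 - X)⁻¹ ^ (4 * p + 6) =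
      (1 + 3 * X + 3 * X ^ 2 + X ^ 3) * invOneSubSqPow (4 * p + 5 + 1) := by
    rw [invOneSubSqPow_eq]
    have hu : (1 + X : ℝ⟦X⟧)⁻¹ ^ 3 * (1 + X) ^ 3 = 1 := by
      rw [← mul_pow, one_add_X_inv_mul, one_pow]
    rw [show 4 * p + 5 + 1 = (4 * p + 3) + 3 by ring, pow_add (1 + X : ℝ⟦X⟧)⁻¹]
    linear_combination (-(1 + X : ℝ⟦X⟧)⁻¹ ^ (4 * p + 3) * (1 - X)⁻¹ ^ (4 * p + 6)) * hu
  have hcoeff : coeff (2 * (p + 1)) ((1 + 3 * X + 3 * X ^ 2 + X ^ 3) *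
      invOneSubSqPow (4 * p + 5 + 1)) =
      (5 * p + 6).choose (4 * p + 5) + 3 * ((5 * p + 5).choose (4 * p + 5) : ℝ) := by
    rw [show (1 + 3 * X + 3 * X ^ 2 + X ^ 3) * invOneSubSqPow (4 * p + 5 + 1) =
      invOneSubSqPow (4 * p + 5 + 1) + ((3 : ℕ) : ℝ⟦X⟧) * (X ^ 1 * invOneSubSqPow (4 * p + 5 + 1)) +
      ((3 : ℕ) : ℝ⟦X⟧) * (X ^ 2 * invOneSubSqPow (4 * p + 5 + 1)) +
        X ^ 3 * invOneSubSqPow (4 * p + 5 + 1) by push_cast; ring]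
    simp only [map_add, coeff_natCast_mul, coeff_X_pow_mul']
    rw [coeff_invOneSubSqPow_two_mul, if_pos (by omega), if_pos (by omega),
      coeff_invOneSubSqPow_of_odd _ (by omega), show 2 * (p + 1) - 2 = 2 * p by omega,
      coeff_invOneSubSqPow_two_mul, show 4 * p + 5 + (p + 1) = 5 * p + 6 by ring,
      show 4 * p + 5 + p = 5 * p + 5 by ring]
    split_ifs with hle
    · rw [coeff_invOneSubSqPow_of_odd _ (by omega)]
      push_cast
      ring
    · push_cast
      ring
  rw [show 2 + 4 * (3 * (p + 1)) + 1 - 4 * (2 * (p + 1) + 1) = 4 * p + 3 by omega,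
    show 2 * (2 * (p + 1) + 1) = 4 * p + 6 by ring, hser, Nat.add_sub_cancel, hcoeff,
    neg_sixtyFour_pow_two_mul_add_one,
    show 2 + 4 * (3 * (p + 1)) = 12 * (p + 1) + 2 by ring, pow_add,
    show 4 * p + 6 + (3 * (p + 1) - (2 * (p + 1) + 1)) = 5 * p + 6 by omega,
    show 5 * p + 6 - 1 = 5 * p + 5 by omega] at h
  obtain ⟨h1, h2⟩ := choose_relations p
  have hpos : 0 < (5 * p + 5).choose (4 * p + 5) := Nat.choose_pos (by omega)
  generalize (5 * p + 5).choose (4 * p + 5) = c at *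
  generalize (5 * p + 6).choose (4 * p + 5) = a at *
  generalize (5 * p + 6).choose (4 * p + 6) + (5 * p + 5).choose (4 * p + 6) = b at *
  have h3 : ((2 * (p + 1) + 1) * 16 * b : ℝ) = (12 * (p + 1) + 2) * (a + 3 * c) := by
    have hpow : (4 : ℝ) * 2 ^ (12 * (p + 1)) ≠ 0 := by positivity
    push_cast at h
    apply mul_left_cancel₀ hpow
    linear_combination -h
  have h4 : (2 * (p + 1) + 1) * 16 * b = (12 * (p + 1) + 2) * (a + 3 * c) := by exact_mod_cast h3
  have h5 : 48 * (p + 1) * (p + 1) * c = (12 * (p + 1) + 2) * ((5 * p + 6) * c + 3 * (p + 1) * c) := by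
    linear_combination (p + 1) * h4 - 8 * (p + 1) * h2 + (12 * (p + 1) + 2) * h1
  have h6 : 0 < (p + 1) * c := by positivity
  -- The right side of `h5` is at least 96(p + 1)²c, twice the left.
  nlinarith

open PowerSeries in
theorem IsSelfDual.not_isMinWeight_of_length_eq_add_six (hC : IsSelfDual C) {p : ℕ}
    {s : Fin n → ZMod 2} (hs : s ∈ shadow C) (hw : hammingNorm s = 3)
    (hn : n = 24 * (p + 1) + 6) : ¬ IsMinWeight C (4 * (p + 1) + 4) := by
  intro hd
  have h := hC.choose_identity hs hw (K := 3 * (p + 1)) (i := 2 * (p + 1) + 1) (by norm_num)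
    (by omega) hd (by omega) (by omega) (by omega) (by omega)
  -- The numerator is (1 + X)²; the even index selects 1 + X².
  have hser : (1 + X : ℝ⟦X⟧)⁻¹ ^ (4 * p + 4) * (1 - X)⁻¹ ^ (4 * p + 6) =
      (1 + 2 * X + X ^ 2) * invOneSubSqPow (4 * p + 5 + 1) := by
    rw [invOneSubSqPow_eq]
    have hu : (1 + X : ℝ⟦X⟧)⁻¹ ^ 2 * (1 + X) ^ 2 = 1 := by
      rw [← mul_pow, one_add_X_inv_mul, one_pow]
    rw [show 4 * p + 5 + 1 = (4 * p + 4) + 2 by ring, pow_add (1 + X : ℝ⟦X⟧)⁻¹]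
    linear_combination (-(1 + X : ℝ⟦X⟧)⁻¹ ^ (4 * p + 4) * (1 - X)⁻¹ ^ (4 * p + 6)) * hu
  have hcoeff : coeff (2 * (p + 1)) ((1 + 2 * X + X ^ 2) * invOneSubSqPow (4 * p + 5 + 1)) =
      (5 * p + 6).choose (4 * p + 5) + ((5 * p + 5).choose (4 * p + 5) : ℝ) := by
    rw [show (1 + 2 * X + X ^ 2) * invOneSubSqPow (4 * p + 5 + 1) =
      invOneSubSqPow (4 * p + 5 + 1) + ((2 : ℕ) : ℝ⟦X⟧) * (X ^ 1 * invOneSubSqPow (4 * p + 5 + 1)) +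
        X ^ 2 * invOneSubSqPow (4 * p + 5 + 1) by push_cast; ring]
    simp only [map_add, coeff_natCast_mul, coeff_X_pow_mul']
    rw [coeff_invOneSubSqPow_two_mul, if_pos (by omega), if_pos (by omega),
      coeff_invOneSubSqPow_of_odd _ (by omega), show 2 * (p + 1) - 2 = 2 * p by omega,
      coeff_invOneSubSqPow_two_mul, show 4 * p + 5 + (p + 1) = 5 * p + 6 by ring,
      show 4 * p + 5 + p = 5 * p + 5 by ring, mul_zero, add_zero]
  rw [show 3 + 4 * (3 * (p + 1)) + 1 - 4 * (2 * (p + 1) + 1) = 4 * p + 4 by omega,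
    show 2 * (2 * (p + 1) + 1) = 4 * p + 6 by ring, hser, Nat.add_sub_cancel, hcoeff,
    neg_sixtyFour_pow_two_mul_add_one,
    show 3 + 4 * (3 * (p + 1)) = 12 * (p + 1) + 3 by ring, pow_add,
    show 4 * p + 6 + (3 * (p + 1) - (2 * (p + 1) + 1)) = 5 * p + 6 by omega,
    show 5 * p + 6 - 1 = 5 * p + 5 by omega] at h
  obtain ⟨h1, h2⟩ := choose_relations p
  have hpos : 0 < (5 * p + 5).choose (4 * p + 5) := Nat.choose_pos (by omega)
  generalize (5 * p + 5).choose (4 * p + 5) = c at *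
  generalize (5 * p + 6).choose (4 * p + 5) = a at *
  generalize (5 * p + 6).choose (4 * p + 6) + (5 * p + 5).choose (4 * p + 6) = b at *
  have h3 : ((2 * (p + 1) + 1) * 8 * b : ℝ) = (12 * (p + 1) + 3) * (a + c) := by
    have hpow : (8 : ℝ) * 2 ^ (12 * (p + 1)) ≠ 0 := by positivity
    push_cast at h
    apply mul_left_cancel₀ hpow
    linear_combination -h
  have h4 : (2 * (p + 1) + 1) * 8 * b = (12 * (p + 1) + 3) * (a + c) := by exact_mod_cast h3
  have h5 : 24 * (p + 1) * (p + 1) * c = (12 * (p + 1) + 3) * ((5 * p + 6) * c + (p + 1) * c) := by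
    linear_combination (p + 1) * h4 - 4 * (p + 1) * h2 + (12 * (p + 1) + 3) * h1
  have h6 : 0 < (p + 1) * c := by positivity
  -- The right side of `h5` is at least 72(p + 1)²c, three times the left.
  nlinarith

end BinaryCode

open BinaryCode in
theorem mainTheorem1 (m n : ℕ)
    (hn : n = 24 * m + 2 ∨ n = 24 * m + 4 ∨ n = 24 * m + 6 ∨ n = 24 * m + 10 ∨
      n = 24 * m + 22) :
    ¬ ∃ C : BinaryCode n,
      BinaryCode.IsSelfDual C ∧ BinaryCode.IsExtremal C ∧ BinaryCode.HasMinimalShadow C := by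
  rintro ⟨C, hC, hext, ⟨s, hs, hsw⟩, -⟩
  rw [IsExtremal, extremalBound] at hext
  rw [minimalShadowWeight] at hsw
  rcases hn with h | h | h | h | h
  · rw [if_neg (by omega), show n / 24 = m by omega] at hext
    rw [if_neg (by omega), show n % 8 / 2 = 1 by omega] at hsw
    rcases m with - | p
    · exact hC.not_isMinWeight_of_length_lt_eight ⟨s, hs⟩ (r := 1) (by omega) (by omega) (by omega)
        (by omega) hext
    · exact hC.not_isMinWeight_of_length_eq_add_two hs hsw h hext
  · rw [if_neg (by omega), show n / 24 = m by omega] at hext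
    rw [if_neg (by omega), show n % 8 / 2 = 2 by omega] at hsw
    rcases m with - | p
    · exact hC.not_isMinWeight_of_length_lt_eight ⟨s, hs⟩ (r := 2) (by omega) (by omega) (by omega)
        (by omega) hext
    · exact hC.not_isMinWeight_of_length_eq_add_four hs hsw h hext
  · rw [if_neg (by omega), show n / 24 = m by omega] at hext
    rw [if_neg (by omega), show n % 8 / 2 = 3 by omega] at hsw
    rcases m with - | p
    · exact hC.not_isMinWeight_of_length_lt_eight ⟨s, hs⟩ (r := 3) (by omega) (by omega) (by omega)
        (by omega) hext
    · exact hC.not_isMinWeight_of_length_eq_add_six hs hsw h hext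
  · rw [if_neg (by omega), show n / 24 = m by omega] at hext
    rw [if_neg (by omega), show n % 8 / 2 = 1 by omega] at hsw
    exact hC.not_isMinWeight_of_length_eq_add_ten hs hsw h hext
  · rw [if_pos (by omega), show n / 24 = m by omega] at hext
    rw [if_neg (by omega), show n % 8 / 2 = 3 by omega] at hsw
    exact hC.not_isMinWeight_of_length_eq_add_twentyTwo hs hsw h hext
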